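/- Let $N\ge 2$ and let $\Omega\subset\mathbb{R}^N$ be a bounded convex domain (nonempty, open). For a real symmetric $N\times N$ matrix $A$ with eigenvalues $\lambda_1,\dots,\lambda_N$ put $S_2(A)=\sum_{1\le i<j\le N}\lambda_i\lambda_j$. Let $f$ be a positive $C^1$ function on $(-\infty,0)$ with $f'\le 0$ there, and let $u\in C^3(\Omega)\cap C^2(\overline\Omega)$ be an admissible solution of $$S_2(D^2u)=f(u)\ \text{ in }\Omega,\qquad u=0\ \text{ on }\partial\Omega,$$ that is, a solution for which the matrix $\big(\partial S_2(D^2u)/\partial u_{ij}\big)_{i,j=1}^N$ is positive definite at every point of $\Omega$. (Such a solution is automatically negative in $\Omega$, so that the equation only involves the values of $f$ on $(-\infty,0)$.) Assume further that there are an interval $I\supset u(\Omega)$ and a strictly increasing function $U\in C^2(I)$ such that $x\mapsto U(u(x))$ is convex in $\Omega$. Then for every real $\alpha\ge 1$ the function $$\Phi(x,\alpha)=|\nabla u(x)|^2+2\alpha\int_{u(x)}^0 f^{1/2}(s)\,ds,\qquad x\in\overline\Omega,$$ attains its minimum over $\overline\Omega$ at a point of $\partial\Omega$. -/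

import Mathlib

noncomputable section

namespace TwoHessian

/-- The `k`-th elementary symmetric function of the `N` eigenvalues (complex roots of the
characteristic polynomial, counted with multiplicity) of a real matrix. It is a real number,
so taking the real part loses nothing; for a symmetric matrix the eigenvalues are real. -/
def S {N : ℕ} (k : ℕ) (A : Matrix (Fin N) (Fin N) ℝ) : ℝ :=
  ((A.map (algebraMap ℝ ℂ)).charpoly.roots.esymm k).re

/-- The matrix `S₂^{ij}(A) = ∂S₂(A)/∂a_{ij}` of partial derivatives of `S₂`
with respect to the entries of the matrix. -/
def S2Deriv {N : ℕ} (A : Matrix (Fin N) (Fin N) ℝ) : Matrix (Fin N) (Fin N) ℝ :=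
  Matrix.of fun i j => deriv (fun t : ℝ => S 2 (A + t • Matrix.single i j (1 : ℝ))) 0

/-- The Hessian matrix `D²u(x)` of second partial derivatives of `u`. -/
def hessian {N : ℕ} (u : EuclideanSpace ℝ (Fin N) → ℝ) (x : EuclideanSpace ℝ (Fin N)) :
    Matrix (Fin N) (Fin N) ℝ :=
  Matrix.of fun i j =>
    fderiv ℝ (fderiv ℝ u) x (EuclideanSpace.single i 1) (EuclideanSpace.single j 1)

/-- `u` is an admissible solution of the Dirichlet problem `S₂(D²u) = f(u)` in `Ω`, `u = 0` on
`∂Ω`: a classical solution at which the equation is elliptic, that is, for which the matrix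
`S₂^{ij}(D²u)` is positive definite throughout `Ω`. -/
structure IsAdmissibleSolution {N : ℕ} (Ω : Set (EuclideanSpace ℝ (Fin N))) (f : ℝ → ℝ)
    (u : EuclideanSpace ℝ (Fin N) → ℝ) : Prop where
  contDiffOn : ContDiffOn ℝ 2 u Ω
  continuousOn : ContinuousOn u (closure Ω)
  equation : ∀ x ∈ Ω, S 2 (hessian u x) = f (u x)
  boundary : ∀ x ∈ frontier Ω, u x = 0
  elliptic : ∀ x ∈ Ω, (S2Deriv (hessian u x)).PosDef

/-- The P-function `Φ(x, α) = |∇u|² + 2α ∫_u^0 f^{1/2}(s) ds` on the closure of `Ω`. On the open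
set `Ω` the gradient within `closure Ω` is the usual gradient; at a boundary point it is the
one-sided gradient, the continuous extension of `∇u` when `u` is `C¹` up to the boundary. -/
def PFunction {N : ℕ} (Ω : Set (EuclideanSpace ℝ (Fin N))) (f : ℝ → ℝ)
    (u : EuclideanSpace ℝ (Fin N) → ℝ) (α : ℝ) (x : EuclideanSpace ℝ (Fin N)) : ℝ :=
  ‖gradientWithin u (closure Ω) x‖ ^ 2 + 2 * α * ∫ s in (u x)..0, Real.sqrt (f s)

end TwoHessian

end

/-! ### `S 2` and its derivative matrix in terms of traces. -/

noncomputable section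

namespace TwoHessian

open Matrix Polynomial

/-! For α > 1, Φ has no local minimum inside Ω. At such a point take an orthonormal eigenbasis of
D²u, with eigenvalues l_k, s = ∑ l_k, gradient components p_k and r = f(u)^{1/2}. The first-order
condition reads p_k (l_k - αr) = 0. If l_k < 0, then p_k = 0, so the k-th eigenvector is tangent to
the level set; convexity of U ∘ u makes the sublevel sets of u convex and forces l_k ≥ 0
(`hessian_eigenvalue_nonneg`). So all l_k ≥ 0.

The contradiction is `minimum_conditions_incompatible`. If ∇u = 0, the second-order conditions make
every nonzero l_k at least αr; ellipticity gives two of them, so S₂ > r² = f. If ∇u ≠ 0, some l_k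
equals αr. Summing the second-order conditions with the weights s - l_i, the diagonal of the
linearised operator, lets the differentiated equation (`differentiated_equation`) replace the third
derivatives by f'|∇u|², and what remains is negative because f' ≤ 0.

On ∂Ω the integral vanishes, so Φ does not depend on α there: one boundary minimiser serves all α >
1, and α = 1 follows by a limit. -/

theorem two_mul_esymm_two {R : Type*} [CommRing R] (s : Multiset R) :
    2 * s.esymm 2 = s.sum ^ 2 - (s.map (· ^ 2)).sum := by
  induction s using Multiset.induction with
  | empty => simp [Multiset.esymm, Multiset.powersetCard_zero_right]
  | cons a s ih =>
    have h : (a ::ₘ s).esymm 2 = s.esymm 2 + a * s.sum := by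
      simp [Multiset.esymm, Multiset.powersetCard_cons, Multiset.powersetCard_one]
      simpa using Multiset.sum_map_mul_left (s := s) (a := a) (f := id)
    rw [h, mul_add, ih]
    simp only [Multiset.sum_cons, Multiset.map_cons]
    ring

/-- Follows from det(z² - B²) = det(z - B) det(z + B), since every complex number is some z².
Multiplicities are kept, which is what the power sum of squares needs. -/
theorem charpoly_mul_self_roots {n : Type*} [Fintype n] [DecidableEq n] (B : Matrix n n ℂ) :
    (B * B).charpoly.roots = B.charpoly.roots.map (· ^ 2) := by
  have hp : ∀ z : ℂ, (scalar n z - B).det = (B.charpoly.roots.map fun r => z - r).prod := by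
    intro z
    rw [← Matrix.eval_charpoly]
    conv_lhs => rw [(IsAlgClosed.splits B.charpoly).eq_prod_roots_of_monic B.charpoly_monic]
    rw [eval_multiset_prod, Multiset.map_map]
    simp
  have hcard : B.charpoly.roots.card = Fintype.card n := by
    rw [← (IsAlgClosed.splits B.charpoly).natDegree_eq_card_roots, B.charpoly_natDegree_eq_dim]
  have hq : (B * B).charpoly = ((B.charpoly.roots.map (· ^ 2)).map fun r => X - C r).prod := by
    refine Polynomial.funext fun w => ?_
    obtain ⟨z, rfl⟩ := IsAlgClosed.exists_pow_nat_eq w (n := 2) two_pos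
    rw [Matrix.eval_charpoly, eval_multiset_prod]
    have h1 : scalar n (z ^ 2) - B * B = (scalar n z - B) * -(scalar n (-z) - B) := by
      have hc : scalar n z * B = B * scalar n z := Matrix.scalar_commute z (fun _ => Commute.all _ _) B
      have h2 : scalar n (z ^ 2) = scalar n z * scalar n z := by rw [← map_mul, sq]
      rw [h2, map_neg, neg_sub, sub_neg_eq_add, sub_mul, mul_add, mul_add, hc]
      abel
    rw [h1, det_mul, det_neg, hp, hp, ← hcard]
    have h3 : ∀ s : Multiset ℂ, (-1 : ℂ) ^ s.card * (s.map fun r => -z - r).prod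
        = (s.map fun r => z + r).prod := by
      intro s
      induction s using Multiset.induction with
      | empty => simp
      | cons a s ih =>
        simp only [Multiset.card_cons, Multiset.map_cons, Multiset.prod_cons, ← ih]
        ring
    rw [h3, ← Multiset.prod_map_mul, Multiset.map_map, Multiset.map_map]
    congr 1
    refine Multiset.map_congr rfl fun r _ => ?_
    simp
    ring
  rw [hq, roots_multiset_prod_X_sub_C]

/-- Newton's identity for the eigenvalues. It turns `S 2` into a polynomial in the entries, which
can be differentiated and is invariant under orthogonal changes of basis. -/
theorem S_two_eq {N : ℕ} (A : Matrix (Fin N) (Fin N) ℝ) :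
    S 2 A = (A.trace ^ 2 - (A * A).trace) / 2 := by
  set B := A.map (algebraMap ℝ ℂ) with hB
  have h1 : B.trace = (A.trace : ℂ) := by
    simp [hB, Matrix.trace]
  have h2 : (B * B).trace = ((A * A).trace : ℂ) := by
    rw [hB, ← Matrix.map_mul]
    simp [Matrix.trace]
  have h3 := two_mul_esymm_two B.charpoly.roots
  rw [← charpoly_mul_self_roots, ← trace_eq_sum_roots_charpoly, ← trace_eq_sum_roots_charpoly,
    h1, h2] at h3
  have h4 := congrArg Complex.re h3
  have h5 : S 2 A = (B.charpoly.roots.esymm 2).re := rfl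
  rw [h5]
  norm_cast at h4
  simp only [Complex.mul_re, Complex.re_ofNat, Complex.im_ofNat] at h4
  linarith

/-- `S 2` is affine in each single entry: the t² terms of the two traces cancel. The entries vary
independently, hence the transpose. -/
theorem S2Deriv_eq {N : ℕ} (A : Matrix (Fin N) (Fin N) ℝ) :
    S2Deriv A = A.trace • (1 : Matrix (Fin N) (Fin N) ℝ) - Aᵀ := by
  ext i j
  simp only [S2Deriv, of_apply, Matrix.sub_apply, Matrix.smul_apply, transpose_apply, smul_eq_mul]
  set d : ℝ := (1 : Matrix (Fin N) (Fin N) ℝ) i j with hd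
  have h1 : (Matrix.single i j (1 : ℝ)).trace = d := by
    by_cases h : i = j
    · subst h; simp [hd, Matrix.trace_single_eq_same]
    · simp [hd, h, Matrix.trace_single_eq_of_ne]
  have h2 : (Matrix.single i j (1 : ℝ) * Matrix.single i j (1 : ℝ)).trace = d ^ 2 := by
    by_cases h : i = j
    · subst h; simp [hd, Matrix.trace_single_eq_same]
    · rw [Matrix.single_mul_single_of_ne]
      · simp [hd, h]
      · exact fun h' => h h'.symm
  have h3 : (A * Matrix.single i j (1 : ℝ)).trace = A j i := by
    simp [Matrix.trace_mul_single]
  have h : ∀ t : ℝ, S 2 (A + t • Matrix.single i j (1 : ℝ))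
      = ((A.trace + t * d) ^ 2 - ((A * A).trace + 2 * t * A j i + t ^ 2 * d ^ 2)) / 2 := by
    intro t
    rw [S_two_eq, trace_add, trace_smul, h1, add_mul, mul_add, mul_add, trace_add, trace_add,
      trace_add, Matrix.smul_mul, Matrix.mul_smul, trace_smul, trace_smul,
      Matrix.trace_mul_comm (Matrix.single i j 1) A, Matrix.smul_mul, Matrix.mul_smul,
      trace_smul, trace_smul, h2, h3]
    simp only [smul_eq_mul]
    ring
  simp_rw [h]
  have h6 : HasDerivAt (fun t : ℝ =>
      ((A.trace + t * d) ^ 2 - ((A * A).trace + 2 * t * A j i + t ^ 2 * d ^ 2)) / 2)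
      (A.trace * d - A j i) 0 := by
    have ht := hasDerivAt_id (0 : ℝ)
    refine (((((ht.mul_const d).const_add A.trace).pow 2).sub
      ((((ht.const_mul 2).mul_const (A j i)).const_add (A * A).trace).add
        ((ht.pow 2).mul_const (d ^ 2)))).div_const 2).congr_deriv ?_
    simp
    ring
  exact h6.deriv

end TwoHessian
end

/-! ### Calculus at a minimum and convexity of sublevel sets. -/

noncomputable section

namespace TwoHessian

open Filter Topology

/-- Second-order necessary condition for a local minimum of a function of one variable. -/
theorem second_deriv_nonneg_of_isLocalMin {g g' : ℝ → ℝ} {c x : ℝ} (hmin : IsLocalMin g x)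
    (h1 : ∀ᶠ t in 𝓝 x, HasDerivAt g (g' t) t) (h2 : HasDerivAt g' c x) : 0 ≤ c := by
  by_contra! hc
  have hd : deriv g =ᶠ[𝓝 x] g' := h1.mono fun t ht => ht.deriv
  have hdd : deriv (deriv g) x = c := by rw [hd.deriv_eq, h2.deriv]
  -- With c < 0 the point is also a local maximum, so g is locally constant and c = 0.
  have hmax : IsLocalMax g x := isLocalMax_of_deriv_deriv_neg (by rwa [hdd]) hmin.deriv_eq_zero
    h1.self_of_nhds.continuousAt
  have hconst : g =ᶠ[𝓝 x] fun _ => g x := by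
    filter_upwards [hmin, hmax] with t ht1 ht2 using le_antisymm ht2 ht1
  have hzero : deriv g =ᶠ[𝓝 x] fun _ => 0 := by
    have := hconst.deriv
    simpa using this
  have : deriv (deriv g) x = 0 := by rw [hzero.deriv_eq]; simp
  linarith

variable {E : Type*} [NormedAddCommGroup E] [NormedSpace ℝ E]

theorem hasDerivAt_comp_curve {F : Type*} [NormedAddCommGroup F] [NormedSpace ℝ F]
    {w : E → F} {γ : ℝ → E} {γ' : E} {t : ℝ}
    (hw : DifferentiableAt ℝ w (γ t)) (hγ : HasDerivAt γ γ' t) :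
    HasDerivAt (fun s => w (γ s)) (fderiv ℝ w (γ t) γ') t :=
  hw.hasFDerivAt.comp_hasDerivAt t hγ

theorem hasDerivAt_line (x e : E) (t : ℝ) : HasDerivAt (fun s : ℝ => x + s • e) e t := by
  simpa using ((hasDerivAt_id t).smul_const e).const_add x

/-- The second derivative of a quasiconvex function is nonnegative in directions tangent to a
regular level set. -/
theorem second_fderiv_nonneg_of_quasiconvexOn {Ω : Set E} {u : E → ℝ} {x e v : E}
    (hΩ : Ω ∈ 𝓝 x) (hu : ContDiffAt ℝ 2 u x) (hq : QuasiconvexOn ℝ Ω u)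
    (he : fderiv ℝ u x e = 0) (hv : 0 < fderiv ℝ u x v) :
    0 ≤ fderiv ℝ (fderiv ℝ u) x e e := by
  by_contra! hc
  set c := fderiv ℝ (fderiv ℝ u) x e e with hcdef
  -- Normalised so that Du(w) = -c/4 > 0. Along the parabola x + te + t²w the second derivative of u
  -- is then c + 2Du(w) = c/2, still negative, while u increases from x in the direction w.
  set w : E := (-c / (4 * fderiv ℝ u x v)) • v with hw
  have hDw : fderiv ℝ u x w = -c / 4 := by
    rw [hw, map_smul, smul_eq_mul]; field_simp
  have hev : ∀ᶠ y in 𝓝 x, DifferentiableAt ℝ u y :=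
    (hu.eventually (by simp)).mono fun y hy => hy.differentiableAt (by simp)
  have hd2 : DifferentiableAt ℝ (fderiv ℝ u) x :=
    (hu.fderiv_right (m := 1) (by norm_num)).differentiableAt (by simp)
  set γ : ℝ → E := fun t => x + t • e + t ^ 2 • w with hγ
  have hγ0 : γ 0 = x := by simp [hγ]
  have hγ' : ∀ t, HasDerivAt γ (e + (2 * t) • w) t := by
    intro t
    refine ((hasDerivAt_line x e t).add ((hasDerivAt_pow 2 t).smul_const w)).congr_deriv ?_
    simp
  have hγt : Tendsto γ (𝓝 0) (𝓝 x) := by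
    have := (hγ' 0).continuousAt.tendsto
    rwa [hγ0] at this
  have h1 : ∀ᶠ t in 𝓝 (0 : ℝ),
      HasDerivAt (fun t => u (γ t)) (fderiv ℝ u (γ t) (e + (2 * t) • w)) t := by
    filter_upwards [hγt.eventually hev] with t ht
    exact hasDerivAt_comp_curve ht (hγ' t)
  have h2 : HasDerivAt (fun t => fderiv ℝ u (γ t) (e + (2 * t) • w)) (c / 2) 0 := by
    have ha : HasDerivAt (fun t => fderiv ℝ u (γ t)) (fderiv ℝ (fderiv ℝ u) x e) 0 := by
      have := hasDerivAt_comp_curve (w := fderiv ℝ u) (γ := γ) (t := 0) (by rwa [hγ0]) (hγ' 0)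
      simpa [hγ0] using this
    have hb : HasDerivAt (fun t : ℝ => e + (2 * t) • w) ((2 : ℝ) • w) 0 := by
      simpa using ((((hasDerivAt_id (0 : ℝ)).const_mul 2).smul_const w).const_add e)
    refine (ha.clm_apply hb).congr_deriv ?_
    simp only [hγ0, map_smul, hDw, mul_zero, zero_smul, add_zero, smul_eq_mul, ← hcdef]
    ring
  have hd : deriv (fun t => u (γ t)) =ᶠ[𝓝 0] fun t => fderiv ℝ u (γ t) (e + (2 * t) • w) :=
    h1.mono fun t ht => ht.deriv
  have hmax : IsLocalMax (fun t => u (γ t)) 0 := by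
    refine isLocalMax_of_deriv_deriv_neg ?_ ?_ h1.self_of_nhds.continuousAt
    · rw [hd.deriv_eq, h2.deriv]; linarith
    · rw [hd.self_of_nhds]; simp [hγ0, he]
  have hψ : HasDerivAt (fun s : ℝ => u (x + s • w)) (-c / 4) 0 := by
    have := hasDerivAt_comp_curve (w := u) (γ := fun s : ℝ => x + s • w) (t := 0)
      (by simpa using hev.self_of_nhds) (hasDerivAt_line x w 0)
    simpa [hDw] using this
  have hψpos : ∀ᶠ s in 𝓝[>] (0 : ℝ), u x < u (x + s • w) := by
    have hs := (hasDerivAt_iff_tendsto_slope.1 hψ).mono_left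
      (nhdsWithin_mono 0 (fun s (hs : 0 < s) => hs.ne'))
    filter_upwards [hs.eventually (lt_mem_nhds (show (0 : ℝ) < -c / 4 by linarith)),
      self_mem_nhdsWithin] with s hs1 hs2
    rw [slope_def_field] at hs1
    have hs2' : (0 : ℝ) < s := hs2
    have := (div_pos_iff_of_pos_right (by linarith : (0 : ℝ) < s - 0)).1 hs1
    simp only [zero_smul, add_zero] at this
    linarith
  have hsq : Tendsto (fun t : ℝ => t ^ 2) (𝓝[>] 0) (𝓝[>] 0) := by
    refine tendsto_nhdsWithin_iff.2 ⟨?_, ?_⟩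
    · have : Tendsto (fun t : ℝ => t ^ 2) (𝓝 0) (𝓝 (0 ^ 2)) := (continuous_pow 2).tendsto 0
      simpa using this.mono_left nhdsWithin_le_nhds
    · filter_upwards [self_mem_nhdsWithin] with t ht
      exact pow_pos (Set.mem_Ioi.1 ht) 2
  have hneg : Tendsto (fun t : ℝ => -t) (𝓝 0) (𝓝 0) := by
    simpa using (continuous_neg (G := ℝ)).tendsto 0
  have hall : ∀ᶠ t in 𝓝[>] (0 : ℝ), False := by
    filter_upwards [hsq.eventually hψpos, nhdsWithin_le_nhds hmax,
      nhdsWithin_le_nhds (hneg.eventually hmax), nhdsWithin_le_nhds (hγt.eventually hΩ),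
      nhdsWithin_le_nhds (hneg.eventually (hγt.eventually hΩ))] with t k1 k2 k3 k4 k5
    simp only [hγ0] at k2 k3
    -- The points γ(t) and γ(-t) lie in the convex sublevel set of height u(x), but their midpoint x
    -- + t²w does not.
    have hmem := (hq (u x)) ⟨k4, k2⟩ ⟨k5, k3⟩ (by norm_num : (0 : ℝ) ≤ 1 / 2)
      (by norm_num : (0 : ℝ) ≤ 1 / 2) (by norm_num)
    have hmid : (1 / 2 : ℝ) • γ t + (1 / 2 : ℝ) • γ (-t) = x + t ^ 2 • w := by
      simp only [hγ]; module
    rw [hmid] at hmem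
    exact absurd hmem.2 (not_le.2 k1)
  exact hall.exists.elim fun _ h => h

/-- A critical point of a function `u` with `U ∘ u` convex, `U` strictly increasing and
differentiable, is a global minimum point. -/
theorem isMinOn_of_fderiv_eq_zero {Ω : Set E} {u : E → ℝ} {x : E} {I : Set ℝ} {U : ℝ → ℝ}
    (hΩ : IsOpen Ω) (hx : x ∈ Ω) (hu : DifferentiableAt ℝ u x) (hI : u '' Ω ⊆ I)
    (hU : DifferentiableWithinAt ℝ U I (u x)) (hmono : StrictMonoOn U I)
    (hconv : ConvexOn ℝ Ω fun y => U (u y)) (hD : fderiv ℝ u x = 0) : IsMinOn u Ω x := by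
  intro y hy
  have hF : HasFDerivAt (fun z => U (u z)) (0 : E →L[ℝ] ℝ) x := by
    have := hU.hasFDerivWithinAt.comp x (hu.hasFDerivAt.hasFDerivWithinAt (s := Ω))
      (fun z hz => hI ⟨z, hz, rfl⟩)
    rw [hD, ContinuousLinearMap.comp_zero] at this
    exact this.hasFDerivAt (hΩ.mem_nhds hx)
  have hg : HasDerivAt (fun t : ℝ => U (u (x + t • (y - x)))) 0 0 := by
    have h0 : HasFDerivAt (fun z => U (u z)) (0 : E →L[ℝ] ℝ) (x + (0 : ℝ) • (y - x)) := by
      simpa using hF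
    exact h0.comp_hasDerivAt (0 : ℝ) (hasDerivAt_line x (y - x) 0)
  have hs := (hasDerivAt_iff_tendsto_slope.1 hg).mono_left
      (nhdsWithin_mono (0 : ℝ) (fun s (hs : s ∈ Set.Ioi (0 : ℝ)) => (Set.mem_Ioi.1 hs).ne'))
  have hle : (0 : ℝ) ≤ U (u y) - U (u x) := by
    refine le_of_tendsto hs ?_
    filter_upwards [Ioo_mem_nhdsGT (zero_lt_one (α := ℝ))] with t ht
    have h := hconv.2 hx hy (by linarith [ht.2] : (0 : ℝ) ≤ 1 - t) ht.1.le (by ring)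
    have hp : (1 - t) • x + t • y = x + t • (y - x) := by module
    rw [hp] at h
    simp only [smul_eq_mul] at h
    rw [slope_def_field, div_le_iff₀ (by linarith [ht.1])]
    simp only [zero_smul, add_zero]
    linarith
  exact (hmono.le_iff_le (hI ⟨x, hx, rfl⟩) (hI ⟨y, hy, rfl⟩)).1 (by linarith)

theorem quasiconvexOn_of_strictMonoOn_comp {Ω : Set E} {u : E → ℝ} {I : Set ℝ} {U : ℝ → ℝ}
    (hI : u '' Ω ⊆ I) (hmono : StrictMonoOn U I) (hconv : ConvexOn ℝ Ω fun y => U (u y)) :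
    QuasiconvexOn ℝ Ω u := by
  rw [quasiconvexOn_iff_le_max]
  refine ⟨hconv.1, fun y hy z hz a b ha hb hab => ?_⟩
  have h := (quasiconvexOn_iff_le_max.1 hconv.quasiconvexOn).2 hy hz ha hb hab
  have hm := hI ⟨_, hconv.1 hy hz ha hb hab, rfl⟩
  rcases le_max_iff.1 h with h | h
  · exact le_max_of_le_left ((hmono.le_iff_le hm (hI ⟨y, hy, rfl⟩)).1 h)
  · exact le_max_of_le_right ((hmono.le_iff_le hm (hI ⟨z, hz, rfl⟩)).1 h)

/-- Symmetry of the third derivative in its outer arguments. -/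
theorem third_fderiv_symm {u : E → ℝ} {x : E} (hu : ContDiffAt ℝ 3 u x) (a b : E) :
    fderiv ℝ (fderiv ℝ (fderiv ℝ u)) x a b b = fderiv ℝ (fderiv ℝ (fderiv ℝ u)) x b b a := by
  have hD : ContDiffAt ℝ 2 (fderiv ℝ u) x := hu.fderiv_right (by norm_num)
  have hQ : DifferentiableAt ℝ (fderiv ℝ (fderiv ℝ u)) x :=
    (hD.fderiv_right (m := 1) (by norm_num)).differentiableAt (by simp)
  -- This swaps the first two slots; differentiating the symmetry of D²u along b then swaps the last
  -- two.
  rw [hD.isSymmSndFDerivAt (by simp) a b]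
  have hsymm : (fun y => fderiv ℝ (fderiv ℝ u) y a b) =ᶠ[𝓝 x]
      fun y => fderiv ℝ (fderiv ℝ u) y b a := by
    filter_upwards [hu.eventually (by simp)] with y hy
    exact (hy.of_le (by norm_num) : ContDiffAt ℝ 2 u y).isSymmSndFDerivAt (by simp) a b
  have happ : ∀ c d : E, HasFDerivAt (fun y => fderiv ℝ (fderiv ℝ u) y c d)
      (((fderiv ℝ (fderiv ℝ (fderiv ℝ u)) x).flip c).flip d) x := by
    intro c d
    refine ((hQ.hasFDerivAt.clm_apply (hasFDerivAt_const c x)).clm_apply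
      (hasFDerivAt_const d x)).congr_fderiv ?_
    ext z
    simp
  have h := congrArg (fun L : E →L[ℝ] ℝ => L b)
    ((happ a b).unique ((happ b a).congr_of_eventuallyEq hsymm))
  simpa using h

/-- First- and second-order conditions at an interior minimum of `∑ (∂ᵢu)² + F(u)`. -/
theorem conditions_of_isLocalMin {ι : Type*} [Fintype ι] {u : E → ℝ} {x : E} {F F1 : ℝ → ℝ}
    {F2 : ℝ} (b : ι → E) (hu : ContDiffAt ℝ 3 u x)
    (hF : ∀ᶠ t in 𝓝 (u x), HasDerivAt F (F1 t) t) (hF1 : HasDerivAt F1 F2 (u x))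
    (hmin : IsLocalMin (fun y => ∑ i, (fderiv ℝ u y (b i)) ^ 2 + F (u y)) x) (e : E) :
    ∑ i, 2 * fderiv ℝ u x (b i) * fderiv ℝ (fderiv ℝ u) x e (b i)
        + F1 (u x) * fderiv ℝ u x e = 0 ∧
    0 ≤ ∑ i, 2 * ((fderiv ℝ (fderiv ℝ u) x e (b i)) ^ 2
          + fderiv ℝ u x (b i) * fderiv ℝ (fderiv ℝ (fderiv ℝ u)) x e e (b i))
        + (F2 * (fderiv ℝ u x e) ^ 2 + F1 (u x) * fderiv ℝ (fderiv ℝ u) x e e) := by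
  have hD : ContDiffAt ℝ 2 (fderiv ℝ u) x := hu.fderiv_right (by norm_num)
  have hQ : DifferentiableAt ℝ (fderiv ℝ (fderiv ℝ u)) x :=
    (hD.fderiv_right (m := 1) (by norm_num)).differentiableAt (by simp)
  set γ : ℝ → E := fun t => x + t • e with hγ
  have hγ0 : γ 0 = x := by simp [hγ]
  have hγ' : ∀ t, HasDerivAt γ e t := hasDerivAt_line x e
  have hγt : Tendsto γ (𝓝 0) (𝓝 x) := by
    have := (hγ' 0).continuousAt.tendsto
    rwa [hγ0] at this
  have hu' : ∀ y, DifferentiableAt ℝ u (γ y) →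
      HasDerivAt (fun t => u (γ t)) (fderiv ℝ u (γ y) e) y :=
    fun y hy => hasDerivAt_comp_curve hy (hγ' y)
  have hD' : ∀ y (c : E), DifferentiableAt ℝ (fderiv ℝ u) (γ y) →
      HasDerivAt (fun t => fderiv ℝ u (γ t) c) (fderiv ℝ (fderiv ℝ u) (γ y) e c) y := by
    intro y c hy
    simpa using (hasDerivAt_comp_curve hy (hγ' y)).clm_apply (hasDerivAt_const y c)
  have hQ' : ∀ c d : E, HasDerivAt (fun t => fderiv ℝ (fderiv ℝ u) (γ t) c d)
      (fderiv ℝ (fderiv ℝ (fderiv ℝ u)) x e c d) 0 := by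
    intro c d
    have h0 : HasDerivAt (fun t => fderiv ℝ (fderiv ℝ u) (γ t))
        (fderiv ℝ (fderiv ℝ (fderiv ℝ u)) x e) 0 := by
      have := hasDerivAt_comp_curve (w := fderiv ℝ (fderiv ℝ u)) (t := 0) (γ := γ)
        (by rwa [hγ0]) (hγ' 0)
      rwa [hγ0] at this
    refine ((h0.clm_apply (hasDerivAt_const (0 : ℝ) c)).clm_apply
      (hasDerivAt_const (0 : ℝ) d)).congr_deriv ?_
    simp
  have hdu : DifferentiableAt ℝ u x := hu.differentiableAt (by simp)
  have hdD : DifferentiableAt ℝ (fderiv ℝ u) x := hD.differentiableAt (by simp)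
  set g' : ℝ → ℝ := fun t =>
    ∑ i, 2 * fderiv ℝ u (γ t) (b i) * fderiv ℝ (fderiv ℝ u) (γ t) e (b i)
      + F1 (u (γ t)) * fderiv ℝ u (γ t) e with hg'
  have h1 : ∀ᶠ t in 𝓝 (0 : ℝ),
      HasDerivAt (fun t => ∑ i, (fderiv ℝ u (γ t) (b i)) ^ 2 + F (u (γ t))) (g' t) t := by
    have hut : Tendsto (fun t => u (γ t)) (𝓝 0) (𝓝 (u x)) := hdu.continuousAt.tendsto.comp hγt
    filter_upwards [hγt.eventually (hu.eventually (by simp)), hut.eventually hF] with t ht hFt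
    have hDt : DifferentiableAt ℝ (fderiv ℝ u) (γ t) :=
      (ht.fderiv_right (m := 2) (by norm_num)).differentiableAt (by simp)
    refine HasDerivAt.add ?_ (hFt.comp t (hu' t (ht.differentiableAt (by simp))))
    refine HasDerivAt.fun_sum fun i _ => ?_
    refine ((hD' t (b i) hDt).pow 2).congr_deriv ?_
    simp
  have hmin' : IsLocalMin (fun t => ∑ i, (fderiv ℝ u (γ t) (b i)) ^ 2 + F (u (γ t))) 0 := by
    have := hγt.eventually hmin
    simp only [IsLocalMin, IsMinFilter, hγ0]
    exact this
  have h2 : HasDerivAt g' (∑ i, 2 * ((fderiv ℝ (fderiv ℝ u) x e (b i)) ^ 2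
          + fderiv ℝ u x (b i) * fderiv ℝ (fderiv ℝ (fderiv ℝ u)) x e e (b i))
        + (F2 * (fderiv ℝ u x e) ^ 2 + F1 (u x) * fderiv ℝ (fderiv ℝ u) x e e)) 0 := by
    have hD0 := fun c => hD' 0 c (by rwa [hγ0])
    have hu0 := hu' 0 (by rwa [hγ0])
    have hF0 : HasDerivAt (fun t => F1 (u (γ t))) (F2 * fderiv ℝ u (γ 0) e) 0 :=
      HasDerivAt.comp (0 : ℝ) (by rwa [hγ0]) hu0
    refine HasDerivAt.add (HasDerivAt.fun_sum fun i _ => ?_) ?_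
    · refine (((hD0 (b i)).const_mul 2).mul (hQ' e (b i))).congr_deriv ?_
      simp only [hγ0]
      ring
    · refine (hF0.mul (hD0 e)).congr_deriv ?_
      simp only [hγ0]
      ring
  refine ⟨?_, second_deriv_nonneg_of_isLocalMin hmin' h1 h2⟩
  have := hmin'.hasDerivAt_eq_zero h1.self_of_nhds
  simpa [hg', hγ0] using this

end TwoHessian
end

/-! ### The algebraic contradiction at an interior minimum. -/

noncomputable section

namespace TwoHessian

open Filter Topology Matrix

/-- Incompatibility of the first- and second-order minimum conditions with the differentiated
equation, in terms of the nonnegative eigenvalues `l` of the Hessian, the components `p` of the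
gradient in an eigenbasis and the third derivatives `T`. -/
theorem minimum_conditions_incompatible {ι : Type*} [Fintype ι] {l p : ι → ℝ} {T : ι → ι → ℝ}
    {α r f1 s : ℝ} (hα : 1 < α) (hr : 0 < r) (hf1 : f1 ≤ 0) (hs : ∑ k, l k = s)
    (hell : ∀ k, 0 < s - l k) (heq : ∑ k, l k * (s - l k) = 2 * r ^ 2)
    (hl : ∀ k, 0 ≤ l k) (hfirst : ∀ k, p k = 0 ∨ l k = α * r)
    (hsecond : ∀ k, 0 ≤ 2 * l k ^ 2 + 2 * ∑ i, p i * T k i - 2 * α * r * l k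
      - α * f1 / r * p k ^ 2)
    (hthird : ∀ i, ∑ k, (s - l k) * T k i = f1 * p i) : False := by
  classical
  have hαr : r < α * r := by nlinarith
  by_cases hp : ∀ k, p k = 0
  -- Critical point: the second-order condition reduces to l_k (l_k - αr) ≥ 0.
  · have hge : ∀ k, l k = 0 ∨ α * r ≤ l k := by
      intro k
      have h := hsecond k
      simp only [hp, zero_mul, Finset.sum_const_zero] at h
      rcases (hl k).eq_or_lt with h0 | h0
      · exact Or.inl h0.symm
      · right
        have : 0 ≤ l k * (l k - α * r) := by nlinarith
        linarith [nonneg_of_mul_nonneg_right this h0]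
    obtain ⟨k, hk⟩ : ∃ k, 0 < l k := by
      by_contra! h
      have : ∑ k, l k * (s - l k) = 0 :=
        Finset.sum_eq_zero fun k _ => by rw [le_antisymm (h k) (hl k), zero_mul]
      nlinarith [sq_pos_of_pos hr]
    have hsk : s - l k = ∑ j ∈ Finset.univ.erase k, l j := by
      rw [← hs, ← Finset.add_sum_erase _ _ (Finset.mem_univ k)]; ring
    obtain ⟨j, hj, hj0⟩ : ∃ j ∈ Finset.univ.erase k, 0 < l j := by
      by_contra! h
      have := hell k
      rw [hsk] at this
      exact absurd (Finset.sum_nonpos h) (not_le.2 this)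
    have hjk := Finset.ne_of_mem_erase hj
    have hlk := (hge k).resolve_left hk.ne'
    have hlj := (hge j).resolve_left hj0.ne'
    have hsum : l k + l j ≤ s := by
      have := Finset.single_le_sum (f := l) (fun i _ => hl i) hj
      linarith
    have hle : l k * (s - l k) + l j * (s - l j) ≤ 2 * r ^ 2 := by
      rw [← heq, ← Finset.add_sum_erase _ _ (Finset.mem_univ k)]
      exact add_le_add_right (Finset.single_le_sum (f := fun i => l i * (s - l i))
        (fun i _ => mul_nonneg (hl i) (hell i).le) hj) _
    nlinarith [mul_lt_mul'' (hαr.trans_le hlk) (hαr.trans_le hlj) hr.le hr.le,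
      mul_le_mul_of_nonneg_left (show l j ≤ s - l k by linarith) hk.le,
      mul_le_mul_of_nonneg_left (show l k ≤ s - l j by linarith) hj0.le]
  · push Not at hp
    obtain ⟨k, hk⟩ := hp
    have hlk : l k = α * r := (hfirst k).resolve_left hk
    set P := ∑ i, p i ^ 2 with hP
    have hP0 : 0 ≤ P := Finset.sum_nonneg fun i _ => sq_nonneg _
    have hsk : s - l k = ∑ j ∈ Finset.univ.erase k, l j := by
      rw [← hs, ← Finset.add_sum_erase _ _ (Finset.mem_univ k)]; ring
    have hlj : ∀ j ∈ Finset.univ.erase k, l j ≤ s - l k := fun j hj => by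
      rw [hsk]; exact Finset.single_le_sum (fun i _ => hl i) hj
    -- Each l_j with j ≠ k is at most s - l_k, so l_k ≤ s - l_j. Hence the k-th term of ∑ l_i (s -
    -- l_i) = 2r² is at most the sum of the others, that is, at most half the total.
    have hprod : α * r * (s - l k) ≤ r ^ 2 := by
      have h1 : l k * (s - l k) ≤ ∑ j ∈ Finset.univ.erase k, l j * (s - l j) := by
        rw [hsk, Finset.mul_sum]
        refine Finset.sum_le_sum fun j hj => ?_
        rw [mul_comm]
        exact mul_le_mul_of_nonneg_left (by linarith [hlj j hj]) (hl j)
      rw [← Finset.add_sum_erase _ _ (Finset.mem_univ k)] at heq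
      rw [← hlk]
      linarith
    have hs1 : α * (s - l k) ≤ r := by
      have : r * (α * (s - l k)) ≤ r * r := by nlinarith
      exact le_of_mul_le_mul_left this hr
    have hs2 : s - l k < α * r := by nlinarith [hell k]
    -- The k-th terms agree; every other l_j is below αr, and ellipticity makes at least one of them
    -- positive, which gives strictness.
    have hstrict : ∑ i, (s - l i) * l i ^ 2 < α * r * ∑ i, l i * (s - l i) := by
      rw [Finset.mul_sum, ← Finset.add_sum_erase _ _ (Finset.mem_univ k),
        ← Finset.add_sum_erase _ _ (Finset.mem_univ k), hlk]
      have hterm : ∀ j ∈ Finset.univ.erase k, (s - l j) * l j ^ 2 ≤ α * r * (l j * (s - l j)) := by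
        intro j hj
        have h1 := hlj j hj
        nlinarith [mul_nonneg (mul_nonneg (hl j) (hell j).le) (by linarith : 0 ≤ α * r - l j)]
      obtain ⟨j, hj, hj0⟩ : ∃ j ∈ Finset.univ.erase k, 0 < l j := by
        by_contra! h
        have := hell k
        rw [hsk] at this
        exact absurd (Finset.sum_nonpos h) (not_le.2 this)
      have := Finset.sum_lt_sum hterm ⟨j, hj, by
        have h1 := hlj j hj
        nlinarith [mul_pos (mul_pos hj0 (hell j)) (by linarith : 0 < α * r - l j)]⟩
      nlinarith
    have hT : ∑ i, (s - l i) * ∑ j, p j * T i j = f1 * P := by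
      simp_rw [Finset.mul_sum]
      rw [Finset.sum_comm, hP, Finset.mul_sum]
      refine Finset.sum_congr rfl fun j _ => ?_
      have := congrArg (fun z => p j * z) (hthird j)
      simp only [Finset.mul_sum] at this
      rw [show f1 * p j ^ 2 = p j * (f1 * p j) by ring, ← this]
      exact Finset.sum_congr rfl fun i _ => by ring
    -- Every i with p_i ≠ 0 has the same eigenvalue αr = l_k, so αr need not be simple.
    have hp2 : ∑ i, (s - l i) * p i ^ 2 = (s - l k) * P := by
      rw [hP, Finset.mul_sum]
      refine Finset.sum_congr rfl fun i _ => ?_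
      rcases hfirst i with h | h
      · rw [h]; ring
      · rw [h, hlk]
    have hsum : 0 ≤ ∑ i, (s - l i) * (2 * l i ^ 2 + 2 * ∑ j, p j * T i j - 2 * α * r * l i
        - α * f1 / r * p i ^ 2) :=
      Finset.sum_nonneg fun i _ => mul_nonneg (hell i).le (hsecond i)
    have hexp : ∑ i, (s - l i) * (2 * l i ^ 2 + 2 * ∑ j, p j * T i j - 2 * α * r * l i
        - α * f1 / r * p i ^ 2) = 2 * ∑ i, (s - l i) * l i ^ 2
        + 2 * ∑ i, (s - l i) * ∑ j, p j * T i j - 2 * (α * r * ∑ i, l i * (s - l i))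
        - α * f1 / r * ∑ i, (s - l i) * p i ^ 2 := by
      simp only [Finset.mul_sum, ← Finset.sum_add_distrib, ← Finset.sum_sub_distrib]
      refine Finset.sum_congr rfl fun i _ => ?_
      have hm2 : ∑ j, 2 * (p j * T i j) = 2 * ∑ j, p j * T i j := (Finset.mul_sum _ _ _).symm
      have hm3 : ∑ j, 2 * ((s - l i) * (p j * T i j)) = 2 * ((s - l i) * ∑ j, p j * T i j) := by
        rw [← Finset.mul_sum, ← Finset.mul_sum]
      simp only [hm2, hm3]
      ring
    rw [hexp, hT, hp2] at hsum
    have hlast : f1 * P * (2 - α * (s - l k) / r) ≤ 0 := by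
      refine mul_nonpos_of_nonpos_of_nonneg (mul_nonpos_of_nonpos_of_nonneg hf1 hP0) ?_
      have : α * (s - l k) / r ≤ 1 := (div_le_one hr).2 hs1
      linarith
    have hrew : α * f1 / r * ((s - l k) * P) = f1 * P * (α * (s - l k) / r) := by ring
    rw [hrew] at hsum
    linarith

/-! ### `S 2` and ellipticity in an orthonormal eigenbasis. -/

section Basis

variable {N : ℕ} (B : EuclideanSpace ℝ (Fin N) →L[ℝ] EuclideanSpace ℝ (Fin N) →L[ℝ] ℝ)

/-- The matrix of a bilinear form in the standard basis. -/
def stdMatrix : Matrix (Fin N) (Fin N) ℝ :=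
  Matrix.of fun i j => B (EuclideanSpace.single i 1) (EuclideanSpace.single j 1)

theorem apply_eq_dotProduct (a c : EuclideanSpace ℝ (Fin N)) :
    B a c = ⇑a ⬝ᵥ (stdMatrix B *ᵥ ⇑c) := by
  have h : ∀ z : EuclideanSpace ℝ (Fin N), z = ∑ i, z i • EuclideanSpace.single i (1 : ℝ) := by
    intro z
    ext j
    simp [Finset.sum_apply, Pi.single_apply]
  conv_lhs => rw [h a, h c]
  simp only [map_sum, map_smul, _root_.sum_apply, _root_.smul_apply,
    smul_eq_mul, dotProduct, mulVec, stdMatrix, Matrix.of_apply, Finset.mul_sum]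
  rw [Finset.sum_comm]
  exact Finset.sum_congr rfl fun i _ => Finset.sum_congr rfl fun j _ => by ring

theorem S_two_stdMatrix (b : OrthonormalBasis (Fin N) ℝ (EuclideanSpace ℝ (Fin N))) :
    S 2 (stdMatrix B)
      = ((∑ i, B (b i) (b i)) ^ 2 - ∑ i, ∑ j, B (b i) (b j) * B (b j) (b i)) / 2 := by
  set Q : Matrix (Fin N) (Fin N) ℝ := Matrix.of fun i k => b i k with hQ
  have hQQ : Q * Qᵀ = 1 := by
    ext i j
    have := orthonormal_iff_ite.1 b.orthonormal i j
    rw [PiLp.inner_apply] at this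
    rw [Matrix.mul_apply, Matrix.one_apply, ← this]
    exact Finset.sum_congr rfl fun k _ => by simp [hQ, mul_comm]
  have hQQ' : Qᵀ * Q = 1 := mul_eq_one_comm.1 hQQ
  have hM : ∀ i j, B (b i) (b j) = (Q * stdMatrix B * Qᵀ) i j := by
    intro i j
    rw [apply_eq_dotProduct, Matrix.mul_assoc, Matrix.mul_apply]
    rfl
  have htr : ∀ M : Matrix (Fin N) (Fin N) ℝ, (Q * M * Qᵀ).trace = M.trace := by
    intro M
    rw [trace_mul_comm, ← Matrix.mul_assoc, hQQ', Matrix.one_mul]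
  have h2 : Q * stdMatrix B * Qᵀ * (Q * stdMatrix B * Qᵀ)
      = Q * (stdMatrix B * stdMatrix B) * Qᵀ := by
    rw [show Q * stdMatrix B * Qᵀ * (Q * stdMatrix B * Qᵀ)
      = Q * stdMatrix B * (Qᵀ * Q) * stdMatrix B * Qᵀ by simp only [Matrix.mul_assoc], hQQ']
    simp only [Matrix.mul_assoc, Matrix.one_mul]
  rw [S_two_eq, ← htr (stdMatrix B), ← htr (stdMatrix B * stdMatrix B), ← h2]
  simp only [hM, Matrix.trace, Matrix.diag_apply, Matrix.mul_apply (M := Q * stdMatrix B * Qᵀ)]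

/-- Testing the positive definite matrix tr(A) I - A on the k-th unit eigenvector gives the
inequality for s - l_k. -/
theorem exists_eigenbasis (hsymm : ∀ a c, B a c = B c a)
    (hell : (S2Deriv (stdMatrix B)).PosDef) :
    ∃ (b : OrthonormalBasis (Fin N) ℝ (EuclideanSpace ℝ (Fin N))) (l : Fin N → ℝ),
      (∀ i j, B (b i) (b j) = if i = j then l i else 0) ∧ ∀ k, 0 < ∑ i, l i - l k := by
  have hA : (stdMatrix B).IsHermitian := by
    ext i j
    simp [stdMatrix, hsymm]
  have hb : ∀ i j, B (hA.eigenvectorBasis i) (hA.eigenvectorBasis j)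
      = if i = j then hA.eigenvalues i else 0 := by
    intro i j
    rw [apply_eq_dotProduct, hA.mulVec_eigenvectorBasis, dotProduct_smul]
    have := orthonormal_iff_ite.1 hA.eigenvectorBasis.orthonormal i j
    rw [PiLp.inner_apply] at this
    have h2 : ⇑(hA.eigenvectorBasis i) ⬝ᵥ ⇑(hA.eigenvectorBasis j) = if i = j then 1 else 0 := by
      rw [← this]
      exact Finset.sum_congr rfl fun k _ => by simp [mul_comm]
    rw [h2]
    split_ifs with h
    · simp [h]
    · simp
  refine ⟨hA.eigenvectorBasis, hA.eigenvalues, hb, fun k => ?_⟩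
  have hne : (⇑(hA.eigenvectorBasis k) : Fin N → ℝ) ≠ 0 := by
    intro h
    exact hA.eigenvectorBasis.orthonormal.ne_zero k (by ext i; exact congrFun h i)
  have hpos := hell.dotProduct_mulVec_pos hne
  have hT : (stdMatrix B)ᵀ = stdMatrix B := by
    ext i j
    simp [stdMatrix, hsymm]
  have htr : (stdMatrix B).trace = ∑ i, hA.eigenvalues i := by simpa using hA.trace_eq_sum_eigenvalues
  have h1 : ⇑(hA.eigenvectorBasis k) ⬝ᵥ ⇑(hA.eigenvectorBasis k) = (1 : ℝ) := by
    have := orthonormal_iff_ite.1 hA.eigenvectorBasis.orthonormal k k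
    rw [PiLp.inner_apply, if_pos rfl] at this
    rw [← this]
    exact Finset.sum_congr rfl fun k _ => by simp [sq]
  rw [S2Deriv_eq, hT, sub_mulVec, smul_mulVec, one_mulVec, hA.mulVec_eigenvectorBasis, star_trivial,
    dotProduct_sub, dotProduct_smul, dotProduct_smul, h1, htr] at hpos
  simpa using hpos

end Basis

theorem hessian_eq_stdMatrix {N : ℕ} (u : EuclideanSpace ℝ (Fin N) → ℝ)
    (x : EuclideanSpace ℝ (Fin N)) :
    hessian u x = stdMatrix (fderiv ℝ (fderiv ℝ u) x) := rfl

/-- The equation `S₂(D²u) = f(u)` differentiated at a point, in an eigenbasis of the Hessian. -/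
theorem differentiated_equation {N : ℕ} {u : EuclideanSpace ℝ (Fin N) → ℝ}
    {x : EuclideanSpace ℝ (Fin N)} {f : ℝ → ℝ} {f1 : ℝ} (hu : ContDiffAt ℝ 3 u x)
    (hf : HasDerivAt f f1 (u x)) (heq : ∀ᶠ y in 𝓝 x, S 2 (hessian u y) = f (u y))
    (b : OrthonormalBasis (Fin N) ℝ (EuclideanSpace ℝ (Fin N))) (l : Fin N → ℝ)
    (hb : ∀ i j, fderiv ℝ (fderiv ℝ u) x (b i) (b j) = if i = j then l i else 0)
    (v : EuclideanSpace ℝ (Fin N)) :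
    ∑ k, (∑ i, l i - l k) * fderiv ℝ (fderiv ℝ (fderiv ℝ u)) x v (b k) (b k)
      = f1 * fderiv ℝ u x v := by
  have hD : ContDiffAt ℝ 2 (fderiv ℝ u) x := hu.fderiv_right (by norm_num)
  have hQ : DifferentiableAt ℝ (fderiv ℝ (fderiv ℝ u)) x :=
    (hD.fderiv_right (m := 1) (by norm_num)).differentiableAt (by simp)
  set γ : ℝ → EuclideanSpace ℝ (Fin N) := fun t => x + t • v with hγ
  have hγ0 : γ 0 = x := by simp [hγ]
  have hγ' : HasDerivAt γ v 0 := hasDerivAt_line x v 0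
  have hγt : Tendsto γ (𝓝 0) (𝓝 x) := by
    have := hγ'.continuousAt.tendsto
    rwa [hγ0] at this
  have hQ' : ∀ i j, HasDerivAt (fun t => fderiv ℝ (fderiv ℝ u) (γ t) (b i) (b j))
      (fderiv ℝ (fderiv ℝ (fderiv ℝ u)) x v (b i) (b j)) 0 := by
    intro i j
    have h0 : HasDerivAt (fun t => fderiv ℝ (fderiv ℝ u) (γ t))
        (fderiv ℝ (fderiv ℝ (fderiv ℝ u)) x v) 0 := by
      have := hasDerivAt_comp_curve (w := fderiv ℝ (fderiv ℝ u)) (t := 0) (γ := γ)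
        (by rwa [hγ0]) hγ'
      rwa [hγ0] at this
    refine ((h0.clm_apply (hasDerivAt_const (0 : ℝ) (b i))).clm_apply
      (hasDerivAt_const (0 : ℝ) (b j))).congr_deriv ?_
    simp
  have hfu : HasDerivAt (fun t => f (u (γ t))) (f1 * fderiv ℝ u x v) 0 := by
    have h := hasDerivAt_comp_curve (w := u) (t := 0) (γ := γ)
      (by rw [hγ0]; exact hu.differentiableAt (by simp)) hγ'
    rw [hγ0] at h
    exact HasDerivAt.comp (0 : ℝ) (by rwa [hγ0]) h
  have hS : HasDerivAt (fun t => ((∑ i, fderiv ℝ (fderiv ℝ u) (γ t) (b i) (b i)) ^ 2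
      - ∑ i, ∑ j, fderiv ℝ (fderiv ℝ u) (γ t) (b i) (b j)
        * fderiv ℝ (fderiv ℝ u) (γ t) (b j) (b i)) / 2)
      (∑ k, (∑ i, l i - l k) * fderiv ℝ (fderiv ℝ (fderiv ℝ u)) x v (b k) (b k)) 0 := by
    refine ((((HasDerivAt.fun_sum fun i _ => hQ' i i).pow 2).sub
      (HasDerivAt.fun_sum fun i _ => HasDerivAt.fun_sum fun j _ =>
        (hQ' i j).mul (hQ' j i))).div_const 2).congr_deriv ?_
    simp only [hγ0, hb, if_true, mul_ite, ite_mul, mul_zero, zero_mul, Finset.sum_add_distrib,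
      Finset.sum_ite_eq, Finset.sum_ite_eq', Finset.mem_univ, sub_mul, Finset.sum_sub_distrib,
      ← Finset.mul_sum]
    have hc : ∑ i, fderiv ℝ (fderiv ℝ (fderiv ℝ u)) x v (b i) (b i) * l i
        = ∑ i, l i * fderiv ℝ (fderiv ℝ (fderiv ℝ u)) x v (b i) (b i) :=
      Finset.sum_congr rfl fun i _ => mul_comm _ _
    rw [hc]
    push_cast
    ring
  refine hS.unique (hfu.congr_of_eventuallyEq ?_)
  filter_upwards [hγt.eventually heq] with t ht
  rw [← ht, hessian_eq_stdMatrix, S_two_stdMatrix _ b]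

end TwoHessian
end

noncomputable section

namespace TwoHessian

open Filter Topology MeasureTheory Set

/-! ### The integral term of Φ up to the endpoint 0. -/

section Primitive

variable {f : ℝ → ℝ}

/-- Nothing is assumed on f at 0; monotonicity bounds f on (t, 0) by f(t). -/
theorem intervalIntegrable_sqrt (hf : ContDiffOn ℝ 1 f (Iio 0)) (hf' : ∀ t < 0, deriv f t ≤ 0)
    {t : ℝ} (ht : t < 0) : IntervalIntegrable (fun s => Real.sqrt (f s)) volume t 0 := by
  have hanti : AntitoneOn f (Iio 0) := by
    refine antitoneOn_of_deriv_nonpos (convex_Iio 0) hf.continuousOn ?_ ?_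
    · rw [interior_Iio]; exact hf.differentiableOn (by simp)
    · rw [interior_Iio]; exact fun s hs => hf' s hs
  have hint : IntegrableOn (fun s => Real.sqrt (f s)) (Ioo t 0) := by
    refine ⟨?_, ?_⟩
    · refine ContinuousOn.aestronglyMeasurable ?_ measurableSet_Ioo
      exact (hf.continuousOn.mono fun s hs => hs.2).sqrt
    · refine HasFiniteIntegral.restrict_of_bounded (C := Real.sqrt (f t)) (by simp) ?_
      rw [ae_restrict_iff' measurableSet_Ioo]
      refine Eventually.of_forall fun s hs => ?_
      rw [Real.norm_of_nonneg (Real.sqrt_nonneg _)]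
      exact Real.sqrt_le_sqrt (hanti ht hs.2 hs.1.le)
  exact (intervalIntegrable_iff_integrableOn_Ioo_of_le ht.le).2 hint

theorem hasDerivAt_integral_sqrt (hf : ContDiffOn ℝ 1 f (Iio 0))
    (hf' : ∀ t < 0, deriv f t ≤ 0) {t : ℝ} (ht : t < 0) :
    HasDerivAt (fun v => ∫ s in v..0, Real.sqrt (f s)) (-Real.sqrt (f t)) t := by
  have hc : ContinuousOn (fun s => Real.sqrt (f s)) (Iio 0) := hf.continuousOn.sqrt
  exact intervalIntegral.integral_hasDerivAt_left (intervalIntegrable_sqrt hf hf' ht)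
    (hc.stronglyMeasurableAtFilter isOpen_Iio t ht) (hc.continuousAt (Iio_mem_nhds ht))

theorem continuousOn_integral_sqrt (hf : ContDiffOn ℝ 1 f (Iio 0))
    (hf' : ∀ t < 0, deriv f t ≤ 0) :
    ContinuousOn (fun v => ∫ s in v..0, Real.sqrt (f s)) (Iic 0) := by
  intro t ht
  have hlt : t - 1 < 0 := by linarith [mem_Iic.1 ht]
  have h := intervalIntegral.continuousOn_primitive_interval_left (a := t - 1) (b := 0)
    (f := fun s => Real.sqrt (f s)) (μ := volume)
    (by simpa [uIcc_of_le hlt.le, integrableOn_Icc_iff_integrableOn_Ioc,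
      intervalIntegrable_iff_integrableOn_Ioc_of_le hlt.le] using
        intervalIntegrable_sqrt hf hf' hlt)
  rw [uIcc_of_le hlt.le] at h
  refine (h t ⟨by linarith, ht⟩).mono_of_mem_nhdsWithin ?_
  filter_upwards [self_mem_nhdsWithin,
    nhdsWithin_le_nhds (Ioi_mem_nhds (show t - 1 < t by linarith))] with s hs hs'
  exact ⟨(mem_Ioi.1 hs').le, hs⟩

end Primitive

/-! ### Admissible solutions and absence of interior minima of Φ. -/

variable {N : ℕ} {Ω : Set (EuclideanSpace ℝ (Fin N))} {f : ℝ → ℝ}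
  {u : EuclideanSpace ℝ (Fin N) → ℝ} {α : ℝ}

theorem exists_hessian_eigenbasis {x : EuclideanSpace ℝ (Fin N)} (hu : ContDiffAt ℝ 2 u x)
    (hell : (S2Deriv (hessian u x)).PosDef) :
    ∃ (b : OrthonormalBasis (Fin N) ℝ (EuclideanSpace ℝ (Fin N))) (l : Fin N → ℝ),
      (∀ i j, fderiv ℝ (fderiv ℝ u) x (b i) (b j) = if i = j then l i else 0) ∧
      ∀ k, 0 < ∑ i, l i - l k :=
  exists_eigenbasis _ (hu.isSymmSndFDerivAt (by simp)) hell

theorem second_fderiv_nonneg_of_isLocalMin {x : EuclideanSpace ℝ (Fin N)}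
    (hu : ContDiffAt ℝ 3 u x) (hmin : IsLocalMin u x) (e : EuclideanSpace ℝ (Fin N)) :
    0 ≤ fderiv ℝ (fderiv ℝ u) x e e := by
  -- An empty family of directions removes the gradient term, leaving u itself.
  have h := (conditions_of_isLocalMin (F := fun t => t) (F1 := fun _ => 1) (F2 := 0)
    (b := fun i : Fin 0 => i.elim0) hu (Eventually.of_forall hasDerivAt_id')
    (hasDerivAt_const _ _) (by simpa using hmin) e).2
  simpa using h

theorem second_fderiv_nonpos_of_isLocalMax {x : EuclideanSpace ℝ (Fin N)}
    (hu : ContDiffAt ℝ 3 u x) (hmax : IsLocalMax u x) (e : EuclideanSpace ℝ (Fin N)) :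
    fderiv ℝ (fderiv ℝ u) x e e ≤ 0 := by
  have h := (conditions_of_isLocalMin (F := fun t => -t) (F1 := fun _ => -1) (F2 := 0)
    (b := fun i : Fin 0 => i.elim0) hu (Eventually.of_forall fun t => (hasDerivAt_id' t).neg)
    (hasDerivAt_const _ _) (by simpa using hmax.neg) e).2
  simpa using h

/-- At a maximum all l_i ≤ 0, whereas ellipticity makes the sum of all but one of them positive. -/
theorem not_isLocalMax_of_elliptic {x : EuclideanSpace ℝ (Fin N)} (hN : 0 < N)
    (hu : ContDiffAt ℝ 3 u x) (hell : (S2Deriv (hessian u x)).PosDef) : ¬ IsLocalMax u x := by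
  intro hmax
  obtain ⟨b, l, hb, hl⟩ := exists_hessian_eigenbasis (hu.of_le (by norm_num)) hell
  have hneg : ∀ k, l k ≤ 0 := fun k => by
    have := second_fderiv_nonpos_of_isLocalMax hu hmax (b k)
    rwa [hb, if_pos rfl] at this
  have h := hl ⟨0, hN⟩
  rw [← Finset.add_sum_erase _ _ (Finset.mem_univ (⟨0, hN⟩ : Fin N))] at h
  linarith [Finset.sum_nonpos fun i (_ : i ∈ Finset.univ.erase (⟨0, hN⟩ : Fin N)) => hneg i]

/-- An admissible solution is negative in the domain. -/
theorem IsAdmissibleSolution.neg (hN : 0 < N) (hΩ : IsOpen Ω) (hb : Bornology.IsBounded Ω)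
    (hu3 : ContDiffOn ℝ 3 u Ω) (hu : IsAdmissibleSolution Ω f u)
    {x : EuclideanSpace ℝ (Fin N)} (hx : x ∈ Ω) : u x < 0 := by
  have hnot : ∀ y ∈ Ω, ¬ IsMaxOn u (closure Ω) y := fun y hy hmax =>
    not_isLocalMax_of_elliptic hN (hu3.contDiffAt (hΩ.mem_nhds hy)) (hu.elliptic y hy)
      (hmax.isLocalMax (mem_of_superset (hΩ.mem_nhds hy) subset_closure))
  obtain ⟨z, hz, hmax⟩ := hb.isCompact_closure.exists_isMaxOn ⟨x, subset_closure hx⟩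
    hu.continuousOn
  have hzf : z ∈ frontier Ω := by
    rw [hΩ.frontier_eq]
    exact ⟨hz, fun h => hnot z h hmax⟩
  have hz0 := hu.boundary z hzf
  have hle : u x ≤ 0 := hz0 ▸ hmax (subset_closure hx)
  refine lt_of_le_of_ne hle fun h0 => hnot x hx fun y hy => ?_
  have : u y ≤ u z := hmax hy
  simpa [h0, hz0] using this

theorem IsAdmissibleSolution.nonpos (hN : 0 < N) (hΩ : IsOpen Ω) (hb : Bornology.IsBounded Ω)
    (hu3 : ContDiffOn ℝ 3 u Ω) (hu : IsAdmissibleSolution Ω f u)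
    {x : EuclideanSpace ℝ (Fin N)} (hx : x ∈ closure Ω) : u x ≤ 0 := by
  by_cases h : x ∈ Ω
  · exact (hu.neg hN hΩ hb hu3 h).le
  · exact (hu.boundary x (by rw [hΩ.frontier_eq]; exact ⟨hx, h⟩)).le

theorem PFunction_eq_of_mem (hΩ : IsOpen Ω) {y : EuclideanSpace ℝ (Fin N)} (hy : y ∈ Ω)
    (b : OrthonormalBasis (Fin N) ℝ (EuclideanSpace ℝ (Fin N))) :
    PFunction Ω f u α y = ∑ i, (fderiv ℝ u y (b i)) ^ 2
      + 2 * α * ∫ s in (u y)..0, Real.sqrt (f s) := by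
  rw [PFunction, ← b.sum_sq_norm_inner_right, gradientWithin,
    fderivWithin_of_mem_nhds (mem_of_superset (hΩ.mem_nhds hy) subset_closure)]
  congr 1
  refine Finset.sum_congr rfl fun i _ => ?_
  rw [real_inner_comm, InnerProductSpace.toDual_symm_apply, Real.norm_eq_abs, sq_abs]

theorem PFunction_eq_of_mem_frontier (hu : IsAdmissibleSolution Ω f u)
    {y : EuclideanSpace ℝ (Fin N)} (hy : y ∈ frontier Ω) :
    PFunction Ω f u α y = ‖gradientWithin u (closure Ω) y‖ ^ 2 := by
  simp [PFunction, hu.boundary y hy]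

theorem continuousOn_PFunction (hN : 0 < N) (hΩ : IsOpen Ω) (hne : Ω.Nonempty)
    (hconv : Convex ℝ Ω) (hb : Bornology.IsBounded Ω) (hf : ContDiffOn ℝ 1 f (Iio 0))
    (hf' : ∀ t < 0, deriv f t ≤ 0) (hu3 : ContDiffOn ℝ 3 u Ω) (hu2 : ContDiffOn ℝ 2 u (closure Ω))
    (hu : IsAdmissibleSolution Ω f u) : ContinuousOn (PFunction Ω f u α) (closure Ω) := by
  -- Convexity with nonempty interior makes the one-sided derivative unique, hence continuous up to
  -- ∂Ω.
  have hud : UniqueDiffOn ℝ (closure Ω) := uniqueDiffOn_convex hconv.closure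
    (hne.mono (hΩ.subset_interior_iff.2 subset_closure))
  have hD := hu2.continuousOn_fderivWithin hud (by norm_num)
  have hG : ContinuousOn (gradientWithin u (closure Ω)) (closure Ω) :=
    (LinearIsometryEquiv.continuous _).comp_continuousOn hD
  refine (hG.norm.pow 2).add (continuousOn_const.mul ?_)
  exact (continuousOn_integral_sqrt hf hf').comp hu2.continuousOn
    fun y hy => hu.nonpos hN hΩ hb hu3 hy

theorem hessian_eigenvalue_nonneg (hΩ : IsOpen Ω) (hu3 : ContDiffOn ℝ 3 u Ω)
    (hU : ∃ (I : Set ℝ) (U : ℝ → ℝ), I.OrdConnected ∧ u '' Ω ⊆ I ∧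
      ContDiffOn ℝ 2 U I ∧ StrictMonoOn U I ∧ ConvexOn ℝ Ω (fun x => U (u x)))
    {x : EuclideanSpace ℝ (Fin N)} (hx : x ∈ Ω) {e : EuclideanSpace ℝ (Fin N)}
    (he : fderiv ℝ u x e = 0) : 0 ≤ fderiv ℝ (fderiv ℝ u) x e e := by
  obtain ⟨I, U, -, hI, hUd, hmono, hconv⟩ := hU
  have hux : ContDiffAt ℝ 3 u x := hu3.contDiffAt (hΩ.mem_nhds hx)
  by_cases hD : fderiv ℝ u x = 0
  · have hmin := isMinOn_of_fderiv_eq_zero hΩ hx (hux.differentiableAt (by simp)) hI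
      (hUd.differentiableOn (by simp) _ (hI ⟨x, hx, rfl⟩)) hmono hconv hD
    exact second_fderiv_nonneg_of_isLocalMin hux (hmin.isLocalMin (hΩ.mem_nhds hx)) e
  · obtain ⟨v, hv⟩ : ∃ v, 0 < fderiv ℝ u x v := by
      by_contra! h
      refine hD (ContinuousLinearMap.ext fun v => le_antisymm (h v) ?_)
      have := h (-v)
      rw [map_neg] at this
      simpa using this
    exact second_fderiv_nonneg_of_quasiconvexOn (hΩ.mem_nhds hx) (hux.of_le (by norm_num))
      (quasiconvexOn_of_strictMonoOn_comp hI hmono hconv) he hv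

theorem not_isLocalMin_PFunction (hN : 0 < N) (hΩ : IsOpen Ω) (hb : Bornology.IsBounded Ω)
    (hf : ContDiffOn ℝ 1 f (Iio 0)) (hfpos : ∀ t < 0, 0 < f t)
    (hf' : ∀ t < 0, deriv f t ≤ 0) (hu3 : ContDiffOn ℝ 3 u Ω) (hu : IsAdmissibleSolution Ω f u)
    (hU : ∃ (I : Set ℝ) (U : ℝ → ℝ), I.OrdConnected ∧ u '' Ω ⊆ I ∧
      ContDiffOn ℝ 2 U I ∧ StrictMonoOn U I ∧ ConvexOn ℝ Ω (fun x => U (u x)))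
    (hα : 1 < α) {x : EuclideanSpace ℝ (Fin N)} (hx : x ∈ Ω) :
    ¬ IsLocalMin (PFunction Ω f u α) x := by
  intro hmin
  have hux : ContDiffAt ℝ 3 u x := hu3.contDiffAt (hΩ.mem_nhds hx)
  obtain ⟨b, l, hbl, hell⟩ := exists_hessian_eigenbasis (hux.of_le (by norm_num))
    (hu.elliptic x hx)
  have hneg : u x < 0 := hu.neg hN hΩ hb hu3 hx
  have hfx := hfpos _ hneg
  set r := Real.sqrt (f (u x)) with hr
  have hr0 : 0 < r := Real.sqrt_pos.2 hfx
  have hr2 : r ^ 2 = f (u x) := Real.sq_sqrt hfx.le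
  have hfd : HasDerivAt f (deriv f (u x)) (u x) :=
    ((hf.contDiffAt (Iio_mem_nhds hneg)).differentiableAt (by simp)).hasDerivAt
  have hmin' : IsLocalMin (fun y => ∑ i, (fderiv ℝ u y (b i)) ^ 2
      + (fun t => 2 * α * ∫ s in t..0, Real.sqrt (f s)) (u y)) x := by
    refine hmin.congr ?_
    filter_upwards [hΩ.mem_nhds hx] with y hy using PFunction_eq_of_mem hΩ hy b
  have hF : ∀ᶠ t in 𝓝 (u x), HasDerivAt (fun t => 2 * α * ∫ s in t..0, Real.sqrt (f s))
      (2 * α * -Real.sqrt (f t)) t := by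
    filter_upwards [Iio_mem_nhds hneg] with t ht
    exact (hasDerivAt_integral_sqrt hf hf' ht).const_mul _
  have hF1 : HasDerivAt (fun t => 2 * α * -Real.sqrt (f t))
      (2 * α * -(deriv f (u x) / (2 * r))) (u x) := (hfd.sqrt hfx.ne').neg.const_mul _
  have hcond := fun k => conditions_of_isLocalMin b hux hF hF1 hmin' (b k)
  refine minimum_conditions_incompatible (l := l) (p := fun k => fderiv ℝ u x (b k))
    (T := fun k i => fderiv ℝ (fderiv ℝ (fderiv ℝ u)) x (b k) (b k) (b i)) (r := r)
    (f1 := deriv f (u x)) hα hr0 (hf' _ hneg) rfl hell ?_ ?_ ?_ ?_ ?_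
  · have h := hu.equation x hx
    rw [hessian_eq_stdMatrix, S_two_stdMatrix _ b] at h
    simp only [hbl, if_true, mul_ite, ite_mul, mul_zero, zero_mul,
      Finset.sum_ite_eq', Finset.mem_univ] at h
    simp only [mul_sub, Finset.sum_sub_distrib, ← Finset.sum_mul]
    rw [hr2, ← h]
    ring
  · intro k
    -- A negative l_k is not αr, so p_k = 0 and the tangential convexity of u applies.
    by_contra! hk
    have h0 : fderiv ℝ u x (b k) = 0 := by
      have h := (hcond k).1
      simp only [hbl, mul_ite, mul_zero, Finset.sum_ite_eq, Finset.mem_univ, if_true] at h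
      have h' : fderiv ℝ u x (b k) * (l k - α * r) = 0 := by linarith
      rcases mul_eq_zero.1 h' with h' | h'
      · exact h'
      · nlinarith [mul_pos (zero_lt_one.trans hα) hr0]
    have := hessian_eigenvalue_nonneg hΩ hu3 hU hx h0
    rw [hbl, if_pos rfl] at this
    linarith
  · intro k
    have h := (hcond k).1
    simp only [hbl, mul_ite, mul_zero, Finset.sum_ite_eq, Finset.mem_univ, if_true] at h
    have h' : fderiv ℝ u x (b k) * (l k - α * r) = 0 := by linarith
    rcases mul_eq_zero.1 h' with h' | h'
    · exact Or.inl h'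
    · exact Or.inr (by linarith)
  · intro k
    have h := (hcond k).2
    simp only [hbl, mul_add, ite_pow, mul_ite, mul_zero, Finset.sum_add_distrib,
      Finset.sum_ite_eq, Finset.mem_univ, if_true, ne_eq, OfNat.ofNat_ne_zero, not_false_eq_true,
      zero_pow, ← Finset.mul_sum] at h
    refine h.trans_eq ?_
    rw [← hr]
    field_simp
    ring
  · intro i
    have h := differentiated_equation hux hfd
      (mem_of_superset (hΩ.mem_nhds hx) fun y hy => hu.equation y hy) b l hbl (b i)
    rw [← h]
    exact Finset.sum_congr rfl fun k _ => by rw [third_fderiv_symm hux (b i) (b k)]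

end TwoHessian
end

/-! ### Passage from α > 1 to α ≥ 1. -/

theorem theorem3 (N : ℕ) (hN : 2 ≤ N)
    (Ω : Set (EuclideanSpace ℝ (Fin N)))
    (hΩ_open : IsOpen Ω) (hΩ_nonempty : Ω.Nonempty)
    (hΩ_convex : Convex ℝ Ω) (hΩ_bounded : Bornology.IsBounded Ω)
    (f : ℝ → ℝ)
    (hf_smooth : ContDiffOn ℝ 1 f (Set.Iio 0))
    (hf_pos : ∀ t < 0, 0 < f t)
    (hf_deriv : ∀ t < 0, deriv f t ≤ 0)
    (u : EuclideanSpace ℝ (Fin N) → ℝ)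
    (hu3 : ContDiffOn ℝ 3 u Ω)
    (hu2 : ContDiffOn ℝ 2 u (closure Ω))
    (hu : TwoHessian.IsAdmissibleSolution Ω f u)
    (hU : ∃ (I : Set ℝ) (U : ℝ → ℝ), I.OrdConnected ∧ u '' Ω ⊆ I ∧
      ContDiffOn ℝ 2 U I ∧ StrictMonoOn U I ∧ ConvexOn ℝ Ω (fun x => U (u x)))
    (α : ℝ) (hα : 1 ≤ α) :
    ∃ x₀ ∈ frontier Ω, IsMinOn (TwoHessian.PFunction Ω f u α) (closure Ω) x₀ := by
  have hN0 : 0 < N := by omega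
  have key : ∀ β : ℝ, 1 < β →
      ∃ z ∈ frontier Ω, IsMinOn (TwoHessian.PFunction Ω f u β) (closure Ω) z := by
    intro β hβ
    obtain ⟨z, hz, hmin⟩ := hΩ_bounded.isCompact_closure.exists_isMinOn hΩ_nonempty.closure
      (TwoHessian.continuousOn_PFunction (α := β) hN0 hΩ_open hΩ_nonempty hΩ_convex hΩ_bounded
        hf_smooth hf_deriv hu3 hu2 hu)
    refine ⟨z, ?_, hmin⟩
    rw [hΩ_open.frontier_eq]
    refine ⟨hz, fun h => ?_⟩
    exact TwoHessian.not_isLocalMin_PFunction hN0 hΩ_open hΩ_bounded hf_smooth hf_pos hf_deriv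
      hu3 hu hU hβ h
      (hmin.isLocalMin (Filter.mem_of_superset (hΩ_open.mem_nhds h) subset_closure))
  -- Any parameter above 1 would do: on the frontier Φ is |∇u|², so `x₀` minimises it there for
  -- every parameter. Letting β decrease to α below then covers α = 1.
  obtain ⟨x₀, hx₀, hmin₀⟩ := key 2 one_lt_two
  refine ⟨x₀, hx₀, fun y hy => ?_⟩
  have hβ : ∀ β : ℝ, 1 < β →
      TwoHessian.PFunction Ω f u α x₀ ≤ TwoHessian.PFunction Ω f u β y := by
    intro β hβ
    obtain ⟨z, hz, hmin⟩ := key β hβ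
    have h1 : TwoHessian.PFunction Ω f u 2 x₀ ≤ TwoHessian.PFunction Ω f u 2 z :=
      hmin₀ (frontier_subset_closure hz)
    have h2 : TwoHessian.PFunction Ω f u β z ≤ TwoHessian.PFunction Ω f u β y := hmin hy
    rw [TwoHessian.PFunction_eq_of_mem_frontier hu hx₀] at h1 ⊢
    rw [TwoHessian.PFunction_eq_of_mem_frontier hu hz] at h1 h2
    exact h1.trans h2
  have hcont : Filter.Tendsto (fun β => TwoHessian.PFunction Ω f u β y)
      (nhdsWithin α (Set.Ioi α)) (nhds (TwoHessian.PFunction Ω f u α y)) := by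
    have : Continuous fun β => TwoHessian.PFunction Ω f u β y := by
      unfold TwoHessian.PFunction
      fun_prop
    exact (this.tendsto α).mono_left nhdsWithin_le_nhds
  refine ge_of_tendsto hcont ?_
  filter_upwards [self_mem_nhdsWithin] with β hβα
  exact hβ β (hα.trans_lt hβα)
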